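/- Let $M$ and $N$ be smooth manifolds (Hausdorff, second countable, without boundary, each of a fixed finite dimension), let $S\subset N$ be a smooth embedded submanifold of some fixed dimension, and let $f:M\to N$ be a smooth map. Say that a smooth map $h:M\to N$ is transverse to $S$ at $x\in M$ if $h(x)\in S$ implies $T_{h(x)}S+\operatorname{im}(dh_x)=T_{h(x)}N$; that $h$ is transverse to $S$ on a set $A\subset M$ if it is transverse to $S$ at every $x\in A$; and that $h$ is transverse to $S$ if it is transverse to $S$ at every point of $M$. Then $f$ is homotopic to a smooth map $g:M\to N$ which is transverse to $S$. Moreover, if $A\subset M$ is a closed subset such that $f$ is transverse to $S$ on $A$, then $g$ can be chosen such that, in addition, $g|_A=f|_A$. -/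

import Mathlib

open scoped Manifold ContDiff

noncomputable section

namespace Transversality

/-- A set `S` of a smooth `n`-manifold `N`, with a smooth `k`-manifold structure on `S` for the
subspace topology, is a smooth (embedded) `k`-dimensional submanifold of `N` if the inclusion
`S → N` is a smooth embedding. -/
structure IsSubmanifold (k n : ℕ) {N : Type*} [TopologicalSpace N]
    [ChartedSpace (EuclideanSpace ℝ (Fin n)) N]
    (S : Set N) [ChartedSpace (EuclideanSpace ℝ (Fin k)) S] : Prop where
  isManifold : IsManifold (𝓡 k) ∞ S
  isSmoothEmbedding : Manifold.IsSmoothEmbedding (𝓡 k) (𝓡 n) ∞ (Subtype.val : S → N)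

/-- The tangent space `T_y S`, as a subspace of `T_y N`: the image of the differential of the
inclusion `S → N` at `y`. -/
def tangentSubspace (k n : ℕ) {N : Type*} [TopologicalSpace N]
    [ChartedSpace (EuclideanSpace ℝ (Fin n)) N]
    (S : Set N) [ChartedSpace (EuclideanSpace ℝ (Fin k)) S] (y : S) :
    Submodule ℝ (TangentSpace (𝓡 n) (y : N)) :=
  LinearMap.range (mfderiv (𝓡 k) (𝓡 n) (Subtype.val : S → N) y).toLinearMap

/-- `f` is transverse to `S` at `x`: if `f x ∈ S`, then `T_{f x} S + im (df_x) = T_{f x} N`. -/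
def TransverseAt (m k n : ℕ) {M N : Type*}
    [TopologicalSpace M] [ChartedSpace (EuclideanSpace ℝ (Fin m)) M]
    [TopologicalSpace N] [ChartedSpace (EuclideanSpace ℝ (Fin n)) N]
    (S : Set N) [ChartedSpace (EuclideanSpace ℝ (Fin k)) S] (f : M → N) (x : M) : Prop :=
  ∀ h : f x ∈ S,
    tangentSubspace k n S ⟨f x, h⟩ ⊔ LinearMap.range (mfderiv (𝓡 m) (𝓡 n) f x).toLinearMap = ⊤

/-- `f` is transverse to `S` on the set `A` of points of the source. -/
def TransverseOn (m k n : ℕ) {M N : Type*}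
    [TopologicalSpace M] [ChartedSpace (EuclideanSpace ℝ (Fin m)) M]
    [TopologicalSpace N] [ChartedSpace (EuclideanSpace ℝ (Fin n)) N]
    (S : Set N) [ChartedSpace (EuclideanSpace ℝ (Fin k)) S] (f : M → N) (A : Set M) : Prop :=
  ∀ x ∈ A, TransverseAt m k n S f x

/-- `f` is transverse to `S`. -/
def Transverse (m k n : ℕ) {M N : Type*}
    [TopologicalSpace M] [ChartedSpace (EuclideanSpace ℝ (Fin m)) M]
    [TopologicalSpace N] [ChartedSpace (EuclideanSpace ℝ (Fin n)) N]
    (S : Set N) [ChartedSpace (EuclideanSpace ℝ (Fin k)) S] (f : M → N) : Prop :=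
  ∀ x, TransverseAt m k n S f x

end Transversality

end

/-
Cover `M` by a locally finite sequence of relatively compact open sets that `f` maps into charts,
and make the map transverse on one of them at a time. In charts the map is perturbed by a bump
function `ρ` times an affine map. Where `ρ ≠ 0`, the 1-jet of the perturbed map determines the
parameters of the affine map. The 1-jets that meet a slice without being transverse to it are
parametrised by spaces of dimension one less than that of the affine maps, since the derivative
followed by the projection to the normal directions takes values in a hyperplane. So the bad
parameters lie in countably many smooth images of open subsets of such spaces; their Hausdorff
dimension is too small to contain an open set, and good parameters are dense.
At a zero of `ρ ≥ 0` the derivative of `ρ` vanishes too, so the perturbation changes neither value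
nor derivative there, and transversality obtained before, or given on `A`, survives. The successive
homotopies are run in disjoint time intervals; by local finiteness each point moves finitely often.
-/

noncomputable section

namespace Transversality

open Set Module Topology Filter

section SuccessiveHomotopies

variable {X Y : Type*} [TopologicalSpace X] [TopologicalSpace Y]

/-- The homotopies `H 0, …, H (n - 1)` performed one after the other, where `H i` takes place
during the time interval `[τ i, τ (i + 1)]`. Time runs over all of `ℝ`; nothing moves before `τ 0`
or after `τ n`. -/
def concatHomotopies {g : ℕ → C(X, Y)} (τ : ℕ → ℝ) (H : ∀ i, (g i).Homotopy (g (i + 1))) :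
    ℕ → ℝ × X → Y
  | 0, p => g 0 p.2
  | n + 1, p =>
    if p.1 ≤ τ n then concatHomotopies τ H n p
    else (H n).extend ((p.1 - τ n) / (τ (n + 1) - τ n)) p.2

section

variable {g : ℕ → C(X, Y)} {τ : ℕ → ℝ} (hτ : StrictMono τ) (H : ∀ i, (g i).Homotopy (g (i + 1)))

include hτ

theorem concatHomotopies_of_le_zero (n : ℕ) {t : ℝ} (ht : t ≤ τ 0) (x : X) :
    concatHomotopies τ H n (t, x) = g 0 x := by
  induction n with
  | zero => rfl
  | succ n ih => rw [concatHomotopies, if_pos (ht.trans (hτ.monotone n.zero_le)), ih]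

theorem concatHomotopies_of_le (n : ℕ) {t : ℝ} (ht : τ n ≤ t) (x : X) :
    concatHomotopies τ H n (t, x) = g n x := by
  cases n with
  | zero => rfl
  | succ n =>
    have hlt : τ n < τ (n + 1) := hτ n.lt_succ_self
    have hend : 1 ≤ (t - τ n) / (τ (n + 1) - τ n) := by
      rw [one_le_div (sub_pos.2 hlt)]
      gcongr
    rw [concatHomotopies, if_neg (hlt.trans_le ht).not_ge, (H n).extend_apply_of_one_le hend]

theorem continuous_concatHomotopies (n : ℕ) : Continuous (concatHomotopies τ H n) := by
  induction n with
  | zero => exact (g 0).continuous.comp continuous_snd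
  | succ n ih =>
    have hH : Continuous fun p : ℝ × X ↦
        H n (projIcc 0 1 zero_le_one ((p.1 - τ n) / (τ (n + 1) - τ n)), p.2) := by fun_prop
    refine ih.if_le hH continuous_fst continuous_const ?_
    rintro ⟨t, x⟩ (rfl : t = τ n)
    rw [concatHomotopies_of_le hτ H n le_rfl, sub_self, zero_div, (H n).extend_zero]

theorem concatHomotopies_succ_of_notMem {W : ℕ → Set X}
    (H : ∀ i, (g i).HomotopyRel (g (i + 1)) (W i)ᶜ) (n : ℕ) (t : ℝ) {x : X} (hx : x ∉ W n) :
    concatHomotopies τ (fun i ↦ (H i).toHomotopy) (n + 1) (t, x) =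
      concatHomotopies τ (fun i ↦ (H i).toHomotopy) n (t, x) := by
  rw [concatHomotopies]
  split_ifs with ht
  · rfl
  · rw [concatHomotopies_of_le hτ _ n (not_le.1 ht).le]
    exact (H n).extendProp _ x hx

theorem concatHomotopies_of_notMem_iUnion {W : ℕ → Set X}
    (H : ∀ i, (g i).HomotopyRel (g (i + 1)) (W i)ᶜ) (n : ℕ) (t : ℝ) {x : X}
    (hx : x ∉ ⋃ i, W i) : concatHomotopies τ (fun i ↦ (H i).toHomotopy) n (t, x) = g 0 x := by
  induction n with
  | zero => rfl
  | succ n ih =>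
    rw [concatHomotopies_succ_of_notMem hτ H n t fun h ↦ hx (mem_iUnion_of_mem n h), ih]

end

theorem exists_homotopicRel_forall_eventually_eventuallyEq {g : ℕ → C(X, Y)} {W : ℕ → Set X}
    (hW : LocallyFinite W) (hg : ∀ i, (g i).HomotopicRel (g (i + 1)) (W i)ᶜ) :
    ∃ G : C(X, Y), (g 0).HomotopicRel G (⋃ i, W i)ᶜ ∧ ∀ x, ∀ᶠ n in atTop, g n =ᶠ[𝓝 x] G := by
  let H (i : ℕ) : (g i).HomotopyRel (g (i + 1)) (W i)ᶜ := (hg i).some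
  obtain ⟨τ, hτ, hτ01, -⟩ := exists_seq_strictMono_tendsto' (zero_lt_one (α := ℝ))
  let K := concatHomotopies τ fun i ↦ (H i).toHomotopy
  have hlf : LocallyFinite fun n ↦ {p | K (n + 1) p ≠ K n p} :=
    (hW.preimage_continuous continuous_snd).subset fun n p hp ↦
      by_contra fun hpW ↦ hp (concatHomotopies_succ_of_notMem hτ H n p.1 hpW)
  obtain ⟨L, hL⟩ := hlf.exists_forall_eventually_atTop_eventuallyEq
  have hLc : Continuous L := continuous_iff_continuousAt.2 fun p ↦
    let ⟨n, hn⟩ := (hL p).exists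
    (continuous_concatHomotopies hτ _ n).continuousAt.congr hn
  have hL0 (x : X) : L (0, x) = g 0 x := by
    obtain ⟨n, hn⟩ := (hL (0, x)).exists
    exact hn.eq_of_nhds.symm.trans (concatHomotopies_of_le_zero hτ _ n (hτ01 0).1.le x)
  have hLrel (t : ℝ) {x : X} (hx : x ∉ ⋃ i, W i) : L (t, x) = g 0 x := by
    obtain ⟨n, hn⟩ := (hL (t, x)).exists
    exact hn.eq_of_nhds.symm.trans (concatHomotopies_of_notMem_iUnion hτ H n t hx)
  refine ⟨⟨fun x ↦ L (1, x), by fun_prop⟩, ⟨⟨⟨⟨fun p ↦ L (p.1, p.2), by fun_prop⟩, hL0,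
    fun x ↦ rfl⟩, fun t x hx ↦ hLrel t hx⟩⟩, fun x ↦ ?_⟩
  filter_upwards [hL (1, x)] with n hn
  filter_upwards [(Continuous.prodMk_right (1 : ℝ)).continuousAt.eventually hn] with x' hx'
  exact (concatHomotopies_of_le hτ _ n (hτ01 n).2.le x').symm.trans hx'

theorem exists_homotopicRel_of_forall_exists_homotopicRel {P : C(X, Y) → Prop}
    {T : C(X, Y) → X → Prop} {W : ℕ → Set X} (hW : LocallyFinite W)
    (hT : ∀ ⦃g g' : C(X, Y)⦄ ⦃x : X⦄, g =ᶠ[𝓝 x] g' → T g x → T g' x)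
    (hstep : ∀ i g, P g → ∃ g', P g' ∧ g.HomotopicRel g' (W i)ᶜ ∧ (∀ x ∈ W i, T g' x) ∧
      ∀ x, T g x → T g' x)
    {f : C(X, Y)} (hf : P f) :
    ∃ g, f.HomotopicRel g (⋃ i, W i)ᶜ ∧ (∀ x, ∃ g', P g' ∧ g' =ᶠ[𝓝 x] g) ∧
      (∀ x ∈ ⋃ i, W i, T g x) ∧ ∀ x, T f x → T g x := by
  choose next hP hrel hTW hTmono using hstep
  let g (i : ℕ) : {g // P g} := Nat.rec ⟨f, hf⟩ (fun i g ↦ ⟨next i g.1 g.2, hP i g.1 g.2⟩) i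
  obtain ⟨G, hfG, hG⟩ := exists_homotopicRel_forall_eventually_eventuallyEq
    (g := fun i ↦ (g i).1) hW fun i ↦ hrel i (g i).1 (g i).2
  have hTG {i : ℕ} {x : X} (hx : T (g i).1 x) : T G x := by
    have hmono (j : ℕ) (hij : i ≤ j) : T (g j).1 x := by
      induction j, hij using Nat.le_induction with
      | base => exact hx
      | succ j _ ih => exact hTmono j (g j).1 (g j).2 x ih
    obtain ⟨j, hj, hij⟩ := ((hG x).and (eventually_ge_atTop i)).exists
    exact hT hj (hmono j hij)
  refine ⟨G, hfG, fun x ↦ ?_, fun x hx ↦ ?_, fun x hx ↦ hTG (i := 0) hx⟩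
  · obtain ⟨i, hi⟩ := (hG x).exists
    exact ⟨(g i).1, (g i).2, hi⟩
  · obtain ⟨i, hi⟩ := mem_iUnion.1 hx
    exact hTG (i := i + 1) (hTW i (g i).1 (g i).2 x hi)

end SuccessiveHomotopies

section Covers

variable {X Y : Type*} [TopologicalSpace X] [TopologicalSpace Y]

theorem exists_nat_locallyFinite_refinement [LindelofSpace X] [ParacompactSpace X] [Nonempty X]
    {V : X → Set X} (hV : ∀ x, V x ∈ 𝓝 x) :
    ∃ (c : ℕ → X) (W : ℕ → Set X), (∀ i, IsOpen (W i)) ∧ ⋃ i, W i = univ ∧ LocallyFinite W ∧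
      ∀ i, W i ⊆ V (c i) := by
  obtain ⟨s, hs, hsV⟩ := countable_cover_nhds fun x ↦ interior_mem_nhds.2 (hV x)
  have hne : s.Nonempty := by
    by_contra! h
    simp [h, eq_comm (a := ∅)] at hsV
  obtain ⟨c, rfl⟩ := hs.exists_eq_range hne
  obtain ⟨W, hWo, hWu, hWlf, hWV⟩ := precise_refinement (fun i ↦ interior (V (c i)))
    (fun _ ↦ isOpen_interior) (by rwa [biUnion_range] at hsV)
  exact ⟨c, W, hWo, hWu, hWlf, fun i ↦ (hWV i).trans interior_subset⟩

theorem isOpen_setOf_forall_mem_imp_mem {ι : Type*} {K : ι → Set X} (hK : LocallyFinite K)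
    (hKc : ∀ i, IsClosed (K i)) {U : ι → Set Y} (hU : ∀ i, IsOpen (U i)) :
    IsOpen {p : X × Y | ∀ i, p.1 ∈ K i → p.2 ∈ U i} := by
  have hclosed : IsClosed (⋃ i, K i ×ˢ (U i)ᶜ) := (hK.prod_right _).isClosed_iUnion fun i ↦
    (hKc i).prod (hU i).isClosed_compl
  convert hclosed.isOpen_compl using 1
  ext p
  simp

end Covers

section HausdorffDimension

variable {X Y : Type*} [NormedAddCommGroup X] [NormedSpace ℝ X]
  [NormedAddCommGroup Y] [NormedSpace ℝ Y]

theorem dimH_image_le_finrank_of_isOpen [FiniteDimensional ℝ X] {f : X → Y} {s : Set X}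
    (hs : IsOpen s) (hf : ContDiffOn ℝ 1 f s) : dimH (f '' s) ≤ finrank ℝ X := by
  rw [← Real.dimH_univ_eq_finrank X]
  refine (dimH_image_le_of_locally_lipschitzOn fun x hx ↦ ?_).trans (dimH_mono (subset_univ s))
  obtain ⟨C, t, ht, hC⟩ := (hf.contDiffAt (hs.mem_nhds hx)).exists_lipschitzOnWith
  exact ⟨C, t, mem_nhdsWithin_of_mem_nhds ht, hC⟩

theorem dense_compl_iUnion_of_dimH_le [FiniteDimensional ℝ X] {ι : Type*} [Countable ι]
    {s : ι → Set X} {d : ℕ} (hd : d < finrank ℝ X) (hs : ∀ i, dimH (s i) ≤ d) :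
    Dense (⋃ i, s i)ᶜ := by
  refine dense_compl_of_dimH_lt_finrank ?_
  rw [dimH_iUnion]
  exact (iSup_le hs).trans_lt (mod_cast hd)

end HausdorffDimension

section LinearAlgebra

variable {X Y Z F ι : Type*}
  [NormedAddCommGroup X] [NormedSpace ℝ X] [NormedAddCommGroup Y] [NormedSpace ℝ Y]
  [NormedAddCommGroup Z] [NormedSpace ℝ Z] [NormedAddCommGroup F] [NormedSpace ℝ F]

theorem finrank_continuousLinearMap [FiniteDimensional ℝ X] [FiniteDimensional ℝ Y] :
    finrank ℝ (X →L[ℝ] Y) = finrank ℝ X * finrank ℝ Y := by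
  rw [← finrank_linearMap ℝ ℝ X Y]
  exact (LinearMap.toContinuousLinearMap (𝕜 := ℝ) (E := X) (F' := Y)).finrank_eq.symm

theorem finrank_ker_coord_add_one [FiniteDimensional ℝ F] (b : Basis ι ℝ F) (i : ι) :
    finrank ℝ (LinearMap.ker (b.coord i)) + 1 = finrank ℝ F :=
  Module.Dual.finrank_ker_add_one_of_ne_zero fun h ↦ by simpa using DFunLike.congr_fun h (b i)

/-- The space of affine maps `x ↦ s.1 + s.2 x` from `X` to `Y`. -/
abbrev AffineParam (X Y : Type*) [NormedAddCommGroup X] [NormedSpace ℝ X]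
    [NormedAddCommGroup Y] [NormedSpace ℝ Y] : Type _ :=
  Y × (X →L[ℝ] Y)

/-- The space parametrizing the linear maps from `X` to `Z × F` whose second component takes its
values in the graph of a linear form over the hyperplane `G` of `F`: such a map is given by its
first component, the linear form, and the projection to `G` of its second component. -/
abbrev HyperplaneParam (X Z : Type*) [NormedAddCommGroup X] [NormedSpace ℝ X]
    [NormedAddCommGroup Z] [NormedSpace ℝ Z] (G : Submodule ℝ F) : Type _ :=
  (X →L[ℝ] Z) × (G →L[ℝ] ℝ) × (X →L[ℝ] G)

/-- The linear map from `X` to `Z × F` with parameter `q`, where the linear form `q.2.1` on the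
hyperplane `G` has its graph in the direction of `e`. -/
def hyperplaneMap (G : Submodule ℝ F) (e : F) (q : HyperplaneParam X Z G) : X →L[ℝ] Z × F :=
  .inl ℝ Z F ∘L q.1 + .inr ℝ Z F ∘L (G.subtypeL ∘L q.2.2 + (q.2.1 ∘L q.2.2).smulRight e)

theorem contDiff_hyperplaneMap (G : Submodule ℝ F) (e : F) :
    ContDiff ℝ ∞ (hyperplaneMap (X := X) (Z := Z) G e) := by
  have h1 : ContDiff ℝ ∞ fun q : HyperplaneParam X Z G ↦ q.1 := by fun_prop
  have h2 : ContDiff ℝ ∞ fun q : HyperplaneParam X Z G ↦ q.2.1 := by fun_prop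
  have h3 : ContDiff ℝ ∞ fun q : HyperplaneParam X Z G ↦ q.2.2 := by fun_prop
  exact (contDiff_const.clm_comp h1).add (contDiff_const.clm_comp
    ((contDiff_const.clm_comp h3).add ((h2.clm_comp h3).smulRight contDiff_const)))

theorem finrank_hyperplaneParam [FiniteDimensional ℝ X] [FiniteDimensional ℝ Y]
    [FiniteDimensional ℝ Z] [FiniteDimensional ℝ F]
    (hdim : finrank ℝ Y = finrank ℝ Z + finrank ℝ F) {G : Submodule ℝ F}
    (hG : finrank ℝ G + 1 = finrank ℝ F) :
    finrank ℝ (X × Z × HyperplaneParam X Z G) = finrank ℝ (AffineParam X Y) - 1 := by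
  simp only [finrank_prod, finrank_continuousLinearMap, finrank_self, hdim, ← hG]
  grind

theorem exists_hyperplaneMap_eq [FiniteDimensional ℝ F] (b : Basis ι ℝ F)
    {L : X →L[ℝ] Z × F}
    (hL : LinearMap.range (.snd ℝ Z F ∘L L).toLinearMap ≠ ⊤) :
    ∃ i q, hyperplaneMap (LinearMap.ker (b.coord i)) (b i) q = L := by
  obtain ⟨l, hl0, hl⟩ := Submodule.exists_le_ker_of_lt_top _ (lt_top_iff_ne_top.2 hL)
  obtain ⟨i, hi⟩ : ∃ i, l (b i) ≠ 0 := by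
    by_contra! h
    exact hl0 (b.ext fun i ↦ by simpa using h i)
  have hlL (x : X) : l (L x).2 = 0 := hl ⟨x, rfl⟩
  let K : X →L[ℝ] F := .snd ℝ Z F ∘L L -
    (LinearMap.toContinuousLinearMap (b.coord i) ∘L .snd ℝ Z F ∘L L).smulRight (b i)
  have hK (x : X) : K x = (L x).2 - b.coord i (L x).2 • b i := rfl
  refine ⟨i, ⟨.fst ℝ Z F ∘L L,
    LinearMap.toContinuousLinearMap (-(l (b i))⁻¹ • l ∘ₗ Submodule.subtype _),
    K.codRestrict _ fun x ↦ by simp [hK]⟩, ?_⟩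
  have hcoord (x : X) : (l (b i))⁻¹ * (b.repr (L x).2 i * l (b i)) = b.repr (L x).2 i := by
    field_simp
  ext x <;> simp [hyperplaneMap, hK, hlL, hcoord]

theorem exists_comp_hyperplaneMap_eq [FiniteDimensional ℝ Y] [FiniteDimensional ℝ F]
    (b : Basis ι ℝ F) {T : Z × F →L[ℝ] Y} (hT : Function.Surjective T) {L : X →L[ℝ] Y}
    (hL : LinearMap.range (T ∘L .inl ℝ Z F).toLinearMap ⊔ LinearMap.range L.toLinearMap ≠ ⊤) :
    ∃ i q, T ∘L hyperplaneMap (LinearMap.ker (b.coord i)) (b i) q = L := by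
  obtain ⟨R, hR⟩ := T.exists_rightInverse_of_surjective (LinearMap.range_eq_top.2 hT)
  have hTR (y : Y) : T (R y) = y := DFunLike.congr_fun hR y
  obtain ⟨i, q, hq⟩ := exists_hyperplaneMap_eq b (L := R ∘L L) fun htop ↦ hL <| by
    refine eq_top_iff.2 fun y _ ↦ ?_
    obtain ⟨v, hv⟩ : (R y).2 ∈ LinearMap.range (.snd ℝ Z F ∘L R ∘L L).toLinearMap :=
      htop ▸ Submodule.mem_top
    have hv : (R (L v)).2 = (R y).2 := hv
    have hfst : ((R (y - L v)).1, (0 : F)) = R (y - L v) := by ext <;> simp [hv]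
    refine Submodule.mem_sup.2 ⟨_, ⟨(R (y - L v)).1, rfl⟩, _, ⟨v, rfl⟩, ?_⟩
    change T ((R (y - L v)).1, 0) + L v = y
    rw [hfst, hTR, sub_add_cancel]
  exact ⟨i, q, by rw [hq, ← ContinuousLinearMap.comp_assoc, hR, ContinuousLinearMap.id_comp]⟩

end LinearAlgebra

section AffinePerturbations

variable {X Y Z F : Type*}
  [NormedAddCommGroup X] [NormedSpace ℝ X] [NormedAddCommGroup Y] [NormedSpace ℝ Y]
  [NormedAddCommGroup Z] [NormedSpace ℝ Z] [NormedAddCommGroup F] [NormedSpace ℝ F]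

/-- The map `h` plus `ρ` times the affine map with parameter `s`, evaluated at the coordinates
`ξ`. On an open set of `X` the coordinates are given by `id`; on a manifold by a chart. -/
def affinePerturb {α : Type*} (h : α → Y) (ξ : α → X) (ρ : α → ℝ) (s : AffineParam X Y) (a : α) :
    Y :=
  h a + ρ a • (s.1 + s.2 (ξ a))

/-- The parameter of the affine perturbation of `u` with factor `c` that has a given 1-jet
`(x, y, L)`, that is, value `y` and derivative `L` at `x`; this supposes `c x ≠ 0`. -/
def affineOfJet (u : X → Y) (c : X → ℝ) (j : X × Y × (X →L[ℝ] Y)) : AffineParam X Y :=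
  let p : Y := (c j.1)⁻¹ • (j.2.1 - u j.1)
  let B : X →L[ℝ] Y := (c j.1)⁻¹ • (j.2.2 - fderiv ℝ u j.1 - (fderiv ℝ c j.1).smulRight p)
  (p - B j.1, B)

variable {u : X → Y} {c : X → ℝ}

theorem fderiv_affinePerturb {x : X} (hu : DifferentiableAt ℝ u x) (hc : DifferentiableAt ℝ c x)
    (s : AffineParam X Y) :
    fderiv ℝ (affinePerturb u id c s) x =
      fderiv ℝ u x + (c x • s.2 + (fderiv ℝ c x).smulRight (s.1 + s.2 x)) :=
  (hu.hasFDerivAt.add (hc.hasFDerivAt.smul (s.2.hasFDerivAt.const_add s.1))).fderiv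

theorem affineOfJet_affinePerturb {x : X} (hu : DifferentiableAt ℝ u x)
    (hc : DifferentiableAt ℝ c x) (hcx : c x ≠ 0) (s : AffineParam X Y) :
    affineOfJet u c (x, affinePerturb u id c s x, fderiv ℝ (affinePerturb u id c s) x) = s := by
  have hp : (c x)⁻¹ • (affinePerturb u id c s x - u x) = s.1 + s.2 x := by
    simp [affinePerturb, inv_smul_smul₀ hcx]
  have hB : (c x)⁻¹ • (fderiv ℝ (affinePerturb u id c s) x - fderiv ℝ u x -
      (fderiv ℝ c x).smulRight (s.1 + s.2 x)) = s.2 := by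
    rw [fderiv_affinePerturb hu hc, add_sub_cancel_left, add_sub_cancel_right, inv_smul_smul₀ hcx]
  simp only [affineOfJet, hp, hB, add_sub_cancel_right]

theorem contDiffOn_affineOfJet {Ω : Set X} (hΩ : IsOpen Ω) (hu : ContDiffOn ℝ ∞ u Ω)
    (hc : ContDiffOn ℝ ∞ c Ω) (hc0 : ∀ x ∈ Ω, c x ≠ 0) :
    ContDiffOn ℝ ∞ (affineOfJet u c) (Prod.fst ⁻¹' Ω) := by
  have hx : ContDiffOn ℝ ∞ (fun j : X × Y × (X →L[ℝ] Y) ↦ j.1) (Prod.fst ⁻¹' Ω) := by fun_prop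
  have hy : ContDiffOn ℝ ∞ (fun j : X × Y × (X →L[ℝ] Y) ↦ j.2.1) (Prod.fst ⁻¹' Ω) := by fun_prop
  have hL : ContDiffOn ℝ ∞ (fun j : X × Y × (X →L[ℝ] Y) ↦ j.2.2) (Prod.fst ⁻¹' Ω) := by fun_prop
  have hinv := (hc.inv hc0).comp hx fun _ h ↦ h
  have hp := hinv.smul (hy.sub (hu.comp hx fun _ h ↦ h))
  have hu' := (hu.fderiv_of_isOpen hΩ (m := ∞) (by simp)).comp hx fun _ h ↦ h
  have hc' := (hc.fderiv_of_isOpen hΩ (m := ∞) (by simp)).comp hx fun _ h ↦ h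
  have hB := hinv.smul ((hL.sub hu').sub (hc'.smulRight hp))
  exact (hp.sub (hB.clm_apply hx)).prodMk hB

/-- Transversality at `x` of a map `v` to the slice `Θ ((Z × 0) ∩ D)`, where `Θ` is supposed to be
a local diffeomorphism on the open set `D`. -/
def TransverseToSliceAt (Θ : Z × F → Y) (D : Set (Z × F)) (v : X → Y) (x : X) : Prop :=
  ∀ z, (z, 0) ∈ D → Θ (z, 0) = v x →
    LinearMap.range (fderiv ℝ Θ (z, 0) ∘L .inl ℝ Z F).toLinearMap ⊔
      LinearMap.range (fderiv ℝ v x).toLinearMap = ⊤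

/-- The 1-jets of maps that meet the slice `Θ ((Z × 0) ∩ D)` without being transverse to it: the
parameter consists of the source point, the point of `Z`, and the derivative read through `Θ`,
which takes its values in a hyperplane as in `hyperplaneMap`. -/
def sliceJet (Θ : Z × F → Y) (G : Submodule ℝ F) (e : F) (q : X × Z × HyperplaneParam X Z G) :
    X × Y × (X →L[ℝ] Y) :=
  (q.1, Θ (q.2.1, 0), fderiv ℝ Θ (q.2.1, 0) ∘L hyperplaneMap G e q.2.2)

variable {Θ : Z × F → Y} {D : Set (Z × F)}

theorem TransverseToSliceAt.congr_of_eventuallyEq {v v' : X → Y} {x : X}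
    (h : TransverseToSliceAt Θ D v x) (hv : v =ᶠ[𝓝 x] v') : TransverseToSliceAt Θ D v' x := by
  simpa only [TransverseToSliceAt, hv.fderiv_eq, hv.eq_of_nhds] using h

theorem contDiffOn_sliceJet (G : Submodule ℝ F) (e : F) (hD : IsOpen D)
    (hΘ : ContDiffOn ℝ ∞ Θ D) :
    ContDiffOn ℝ ∞ (sliceJet (X := X) Θ G e) {q | (q.2.1, 0) ∈ D} := by
  have hz : ContDiff ℝ ∞ fun q : X × Z × HyperplaneParam X Z G ↦ (q.2.1, (0 : F)) := by fun_prop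
  have hq : ContDiff ℝ ∞ fun q : X × Z × HyperplaneParam X Z G ↦ q.2.2 := by fun_prop
  have hΘz := (hΘ.fderiv_of_isOpen hD (m := ∞) (by simp)).comp hz.contDiffOn fun q hq ↦ hq
  exact contDiff_fst.contDiffOn.prodMk ((hΘ.comp hz.contDiffOn fun q hq ↦ hq).prodMk
    (hΘz.clm_comp ((contDiff_hyperplaneMap G e).comp hq).contDiffOn))

variable [FiniteDimensional ℝ Y] [FiniteDimensional ℝ F]

theorem exists_sliceJet_eq_of_not_transverseToSliceAt {ι : Type*} (b : Basis ι ℝ F)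
    (hΘ : ∀ p ∈ D, Function.Surjective (fderiv ℝ Θ p)) {v : X → Y} {x : X}
    (hv : ¬ TransverseToSliceAt Θ D v x) :
    ∃ i z q, (z, 0) ∈ D ∧
      sliceJet Θ (LinearMap.ker (b.coord i)) (b i) (x, z, q) = (x, v x, fderiv ℝ v x) := by
  simp only [TransverseToSliceAt, not_forall] at hv
  obtain ⟨z, hzD, hzx, hne⟩ := hv
  obtain ⟨i, q, hq⟩ := exists_comp_hyperplaneMap_eq b (hΘ _ hzD) hne
  exact ⟨i, z, q, hzD, by rw [sliceJet, hzx, hq]⟩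

theorem dimH_setOf_not_transverseToSliceAt_le [FiniteDimensional ℝ X] [FiniteDimensional ℝ Z]
    {Ω : Set X} (hΩ : IsOpen Ω) (hu : ContDiffOn ℝ ∞ u Ω) (hc : ContDiffOn ℝ ∞ c Ω)
    (hc0 : ∀ x ∈ Ω, c x ≠ 0) (hD : IsOpen D) (hΘ : ContDiffOn ℝ ∞ Θ D)
    (hΘ' : ∀ p ∈ D, Function.Surjective (fderiv ℝ Θ p))
    (hdim : finrank ℝ Y = finrank ℝ Z + finrank ℝ F) :
    dimH {s : AffineParam X Y | ∃ x ∈ Ω, ¬ TransverseToSliceAt Θ D (affinePerturb u id c s) x} ≤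
      (finrank ℝ (AffineParam X Y) - 1 : ℕ) := by
  let b := Module.finBasis ℝ F
  let G (i : Fin (finrank ℝ F)) : Submodule ℝ F := LinearMap.ker (b.coord i)
  let V (i : Fin (finrank ℝ F)) : Set (X × Z × HyperplaneParam X Z (G i)) :=
    {q | q.1 ∈ Ω} ∩ {q | (q.2.1, 0) ∈ D}
  let Ψ (i : Fin (finrank ℝ F)) : X × Z × HyperplaneParam X Z (G i) → AffineParam X Y :=
    affineOfJet u c ∘ sliceJet Θ (G i) (b i)
  have hV (i) : IsOpen (V i) := (hΩ.preimage continuous_fst).inter (hD.preimage (by fun_prop))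
  have hΨ (i) : ContDiffOn ℝ 1 (Ψ i) (V i) :=
    ((contDiffOn_affineOfJet hΩ hu hc hc0).comp
      ((contDiffOn_sliceJet (G i) (b i) hD hΘ).mono inter_subset_right)
        fun q hq ↦ hq.1).of_le (by simp)
  have hdimV (i) : dimH (Ψ i '' V i) ≤ (finrank ℝ (AffineParam X Y) - 1 : ℕ) :=
    (dimH_image_le_finrank_of_isOpen (hV i) (hΨ i)).trans_eq <| by
      rw [finrank_hyperplaneParam hdim (finrank_ker_coord_add_one b i)]
  refine (dimH_mono (t := ⋃ i, Ψ i '' V i) ?_).trans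
    ((dimH_iUnion _).trans_le (iSup_le hdimV))
  rintro s ⟨x, hx, hs⟩
  obtain ⟨i, z, q, hzD, hq⟩ := exists_sliceJet_eq_of_not_transverseToSliceAt b hΘ' hs
  have hux := (hu.contDiffAt (hΩ.mem_nhds hx)).differentiableAt (by simp)
  have hcx := (hc.contDiffAt (hΩ.mem_nhds hx)).differentiableAt (by simp)
  exact mem_iUnion.2 ⟨i, (x, z, q), ⟨hx, hzD⟩,
    (congrArg (affineOfJet u c) hq).trans (affineOfJet_affinePerturb hux hcx (hc0 x hx) s)⟩

end AffinePerturbations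

section Slices

theorem mdifferentiable_of_mem_maximalAtlas {E H N : Type*} [NormedAddCommGroup E]
    [NormedSpace ℝ E] [TopologicalSpace H] {I : ModelWithCorners ℝ E H} [TopologicalSpace N]
    [ChartedSpace H N] {φ : OpenPartialHomeomorph N H} (hφ : φ ∈ IsManifold.maximalAtlas I ∞ N) :
    φ.MDifferentiable I I :=
  ⟨(contMDiffOn_of_mem_maximalAtlas hφ).mdifferentiableOn (by simp),
    (contMDiffOn_symm_of_mem_maximalAtlas hφ).mdifferentiableOn (by simp)⟩

variable {k n : ℕ} {P N F : Type*} [TopologicalSpace P] [ChartedSpace (EuclideanSpace ℝ (Fin k)) P]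
  [TopologicalSpace N] [ChartedSpace (EuclideanSpace ℝ (Fin n)) N]
  [NormedAddCommGroup F] [NormedSpace ℝ F]

variable {ι : P → N} {y : P} (hy : Manifold.IsImmersionAtOfComplement F (𝓡 k) (𝓡 n) ∞ ι y)
  (φ : OpenPartialHomeomorph N (EuclideanSpace ℝ (Fin n)))

/-- Straightening of an immersion `ι` near `y`: the local diffeomorphism that, in the chart `φ`,
identifies the image of `ι` with the slice `ℝᵏ × 0`. -/
def sliceMap : OpenPartialHomeomorph (EuclideanSpace ℝ (Fin k) × F) (EuclideanSpace ℝ (Fin n)) :=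
  hy.equiv.toHomeomorph.toOpenPartialHomeomorph.trans (hy.codChart.symm.trans φ)

variable {φ}

theorem mem_sliceMap_source {p : EuclideanSpace ℝ (Fin k) × F} :
    p ∈ (sliceMap hy φ).source ↔
      hy.equiv p ∈ hy.codChart.target ∧ hy.codChart.symm (hy.equiv p) ∈ φ.source := by
  simp [sliceMap]

theorem contDiffOn_sliceMap (hφ : φ ∈ IsManifold.maximalAtlas (𝓡 n) ∞ N) :
    ContDiffOn ℝ ∞ (sliceMap hy φ) (sliceMap hy φ).source := by
  have hequiv : ContMDiffOn 𝓘(ℝ, EuclideanSpace ℝ (Fin k) × F) (𝓡 n) ∞ hy.equiv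
      (sliceMap hy φ).source := hy.equiv.contDiff.contMDiff.contMDiffOn
  have hcod := (contMDiffOn_symm_of_mem_maximalAtlas hy.codChart_mem_maximalAtlas).comp hequiv
    fun p hp ↦ ((mem_sliceMap_source hy).1 hp).1
  exact ((contMDiffOn_of_mem_maximalAtlas hφ).comp hcod
    fun p hp ↦ ((mem_sliceMap_source hy).1 hp).2).contDiffOn

theorem surjective_fderiv_sliceMap (hφ : φ ∈ IsManifold.maximalAtlas (𝓡 n) ∞ N)
    {p : EuclideanSpace ℝ (Fin k) × F} (hp : p ∈ (sliceMap hy φ).source) :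
    Function.Surjective (fderiv ℝ (sliceMap hy φ) p) := by
  have hequiv : hy.equiv.toHomeomorph.toOpenPartialHomeomorph.MDifferentiable
      𝓘(ℝ, EuclideanSpace ℝ (Fin k) × F) (𝓡 n) :=
    ⟨hy.equiv.differentiable.mdifferentiable.mdifferentiableOn,
      hy.equiv.symm.differentiable.mdifferentiable.mdifferentiableOn⟩
  have hslice := hequiv.trans
    ((mdifferentiable_of_mem_maximalAtlas hy.codChart_mem_maximalAtlas).symm.trans
      (mdifferentiable_of_mem_maximalAtlas hφ))
  rw [← mfderiv_eq_fderiv]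
  exact hslice.mfderiv_surjective hp

variable {y' : P} (hy' : y' ∈ hy.domChart.source)

include hy'

theorem equiv_domChart : hy.equiv (hy.domChart y', 0) = hy.codChart (ι y') := by
  have hz : hy.domChart y' ∈ (hy.domChart.extend (𝓡 k)).target := by
    simpa using hy.domChart.map_source hy'
  simpa [hy'] using (hy.writtenInCharts hz).symm

theorem sliceMap_domChart : sliceMap hy φ (hy.domChart y', 0) = φ (ι y') := by
  change φ (hy.codChart.symm (hy.equiv (hy.domChart y', 0))) = _
  rw [equiv_domChart hy hy', hy.codChart.left_inv (hy.source_subset_preimage_source hy')]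

theorem domChart_mem_sliceMap_source (hφy' : ι y' ∈ φ.source) :
    (hy.domChart y', 0) ∈ (sliceMap hy φ).source := by
  have hcod : ι y' ∈ hy.codChart.source := hy.source_subset_preimage_source hy'
  rw [mem_sliceMap_source, equiv_domChart hy hy', hy.codChart.left_inv hcod]
  exact ⟨hy.codChart.map_source hcod, hφy'⟩

theorem fderiv_sliceMap_comp_inl (hφ : φ ∈ IsManifold.maximalAtlas (𝓡 n) ∞ N)
    (hφy' : ι y' ∈ φ.source) :
    (fderiv ℝ (sliceMap hy φ) (hy.domChart y', 0) ∘L .inl ℝ _ F) ∘L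
        mfderiv (𝓡 k) (𝓡 k) hy.domChart y' =
      mfderiv (𝓡 n) (𝓡 n) φ (ι y') ∘L mfderiv (𝓡 k) (𝓡 n) ι y' := by
  have hsrc := domChart_mem_sliceMap_source hy hy' hφy'
  have hslice : DifferentiableAt ℝ (sliceMap hy φ) (hy.domChart y', 0) :=
    ((contDiffOn_sliceMap hy hφ).contDiffAt
      ((sliceMap hy φ).open_source.mem_nhds hsrc)).differentiableAt (by simp)
  have hdom : MDifferentiableAt (𝓡 k) (𝓡 k) hy.domChart y' :=
    (mdifferentiable_of_mem_maximalAtlas hy.domChart_mem_maximalAtlas).mdifferentiableAt hy'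
  have hι : MDifferentiableAt (𝓡 k) (𝓡 n) ι y' := (hy.contMDiffOn.contMDiffAt
    (hy.domChart.open_source.mem_nhds hy')).mdifferentiableAt (by simp)
  have hφd := (mdifferentiable_of_mem_maximalAtlas hφ).mdifferentiableAt hφy'
  have hinl : HasMFDerivAt (𝓡 k) (𝓡 n) (fun z ↦ sliceMap hy φ (z, 0)) (hy.domChart y')
      (fderiv ℝ (sliceMap hy φ) (hy.domChart y', 0) ∘L .inl ℝ (EuclideanSpace ℝ (Fin k)) F) :=
    (hslice.hasFDerivAt.comp (hy.domChart y')
      (hasFDerivAt_prodMk_left (hy.domChart y') (0 : F))).hasMFDerivAt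
  refine ((hinl.comp y' hdom.hasMFDerivAt).congr_of_eventuallyEq ?_).mfderiv.symm.trans
    (mfderiv_comp y' hφd hι)
  filter_upwards [hy.domChart.open_source.mem_nhds hy'] with w hw
  exact (sliceMap_domChart hy hw).symm

end Slices

section Derivative

variable {E H M V : Type*} [NormedAddCommGroup E] [NormedSpace ℝ E] [TopologicalSpace H]
  {I : ModelWithCorners ℝ E H} [I.Boundaryless] [TopologicalSpace M] [ChartedSpace H M]
  [NormedAddCommGroup V] [NormedSpace ℝ V] {ρ : M → ℝ} {h : M → V} {x : M}

theorem mvfderiv_eq_zero_of_isLocalMin (hmin : IsLocalMin ρ x) : mvfderiv I ρ x = 0 := by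
  by_cases hρ : MDifferentiableAt I 𝓘(ℝ, ℝ) ρ x
  · have hsymm : Tendsto (extChartAt I x).symm (𝓝 (extChartAt I x x)) (𝓝 x) := by
      simpa using! (continuousAt_extChartAt_symm (I := I) x).tendsto
    have hmin' : IsLocalMin (ρ ∘ (extChartAt I x).symm) (extChartAt I x x) := by
      simpa [IsLocalMin, IsMinFilter] using hsymm.eventually hmin
    rw [mvfderiv, hρ.mfderiv, I.range_eq_univ, fderivWithin_univ]
    exact hmin'.fderiv_eq_zero
  · rw [mvfderiv, mfderiv_zero_of_not_mdifferentiableAt hρ, ContinuousLinearMap.comp_zero]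

theorem mvfderiv_smul_eq_zero_of_isLocalMin (hρ : MDifferentiableAt I 𝓘(ℝ, ℝ) ρ x)
    (hmin : IsLocalMin ρ x) (hρ0 : ρ x = 0) (hh : MDifferentiableAt I 𝓘(ℝ, V) h x) :
    mvfderiv I (ρ • h) x = 0 := by
  rw [mvfderiv_smul hρ hh, mvfderiv_eq_zero_of_isLocalMin hmin, hρ0, zero_smul, zero_add,
    ContinuousLinearMap.zero_smulRight]

end Derivative

section Transversality

variable {m k n : ℕ} {M N : Type*}
  [TopologicalSpace M] [ChartedSpace (EuclideanSpace ℝ (Fin m)) M]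
  [TopologicalSpace N] [ChartedSpace (EuclideanSpace ℝ (Fin n)) N]
  {S : Set N} [ChartedSpace (EuclideanSpace ℝ (Fin k)) S] {g g' : M → N} {x : M}
  {φ : OpenPartialHomeomorph N (EuclideanSpace ℝ (Fin n))}

theorem TransverseAt.congr_of_mfderiv_eq (h : TransverseAt m k n S g x) (hx : g' x = g x)
    (hd : (mfderiv (𝓡 m) (𝓡 n) g' x : EuclideanSpace ℝ (Fin m) →L[ℝ] EuclideanSpace ℝ (Fin n)) =
      mfderiv (𝓡 m) (𝓡 n) g x) : TransverseAt m k n S g' x := by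
  let P (y : N) (L : EuclideanSpace ℝ (Fin m) →L[ℝ] EuclideanSpace ℝ (Fin n)) : Prop :=
    ∀ h : y ∈ S, (tangentSubspace k n S ⟨y, h⟩ : Submodule ℝ (EuclideanSpace ℝ (Fin n))) ⊔
      LinearMap.range L.toLinearMap = ⊤
  change P (g x) (mfderiv (𝓡 m) (𝓡 n) g x) at h
  change P (g' x) (mfderiv (𝓡 m) (𝓡 n) g' x)
  rwa [hx, hd]

theorem TransverseAt.congr_of_eventuallyEq (h : TransverseAt m k n S g x) (hg : g' =ᶠ[𝓝 x] g) :
    TransverseAt m k n S g' x :=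
  h.congr_of_mfderiv_eq hg.eq_of_nhds hg.mfderiv_eq

theorem TransverseAt.of_chart_comp_eventuallyEq_add (h : TransverseAt m k n S g x)
    (hg : MDifferentiableAt (𝓡 m) (𝓡 n) g x) (hg' : MDifferentiableAt (𝓡 m) (𝓡 n) g' x)
    (hφ : φ.MDifferentiable (𝓡 n) (𝓡 n)) (hx : g x ∈ φ.source) (hx' : g' x ∈ φ.source)
    {β : M → EuclideanSpace ℝ (Fin n)} (hβ : MDifferentiableAt (𝓡 m) (𝓡 n) β x) (hβ0 : β x = 0)
    (hβ' : mvfderiv (𝓡 m) β x = 0) (heq : φ ∘ g' =ᶠ[𝓝 x] φ ∘ g + β) :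
    TransverseAt m k n S g' x := by
  have hval : g' x = g x := φ.injOn hx' hx (by simpa [hβ0] using heq.eq_of_nhds)
  have hadd : mvfderiv (𝓡 m) (φ ∘ g') x = mvfderiv (𝓡 m) (φ ∘ g) x := by
    have hgerm : mvfderiv (𝓡 m) (φ ∘ g') x = mvfderiv (𝓡 m) (φ ∘ g + β) x :=
      ContinuousLinearMap.ext fun v ↦ DFunLike.congr_fun heq.mfderiv_eq v
    rw [hgerm, mvfderiv_add ((hφ.mdifferentiableAt hx).comp x hg) hβ, hβ', add_zero]
  refine h.congr_of_mfderiv_eq hval (ContinuousLinearMap.ext fun v ↦ ?_)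
  rw [mvfderiv, mvfderiv, mfderiv_comp x (hφ.mdifferentiableAt hx') hg',
    mfderiv_comp x (hφ.mdifferentiableAt hx) hg, hval] at hadd
  exact hφ.mfderiv_injective hx (DFunLike.congr_fun hadd v)

variable {F : Type*} [NormedAddCommGroup F] [NormedSpace ℝ F]

theorem transverseAt_of_transverseToSliceAt {y : S}
    (hy : Manifold.IsImmersionAtOfComplement F (𝓡 k) (𝓡 n) ∞ (Subtype.val : S → N) y)
    (hg : MDifferentiableAt (𝓡 m) (𝓡 n) g x) (hφ : φ ∈ IsManifold.maximalAtlas (𝓡 n) ∞ N)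
    (hxφ : g x ∈ φ.source) {ψ : OpenPartialHomeomorph M (EuclideanSpace ℝ (Fin m))}
    (hψ : ψ.MDifferentiable (𝓡 m) (𝓡 m)) (hxψ : x ∈ ψ.source)
    (hxy : ∀ hS : g x ∈ S, ⟨g x, hS⟩ ∈ hy.domChart.source)
    (h : TransverseToSliceAt (sliceMap hy φ) (sliceMap hy φ).source (φ ∘ g ∘ ψ.symm) (ψ x)) :
    TransverseAt m k n S g x := by
  intro hS
  have hsymm : ψ.symm (ψ x) = x := ψ.left_inv hxψ
  have hφ' := mdifferentiable_of_mem_maximalAtlas hφ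
  have hslice : LinearMap.range (fderiv ℝ (sliceMap hy φ) (hy.domChart ⟨g x, hS⟩, 0) ∘L
      .inl ℝ (EuclideanSpace ℝ (Fin k)) F).toLinearMap ≤
      (tangentSubspace k n S ⟨g x, hS⟩).map (mfderiv (𝓡 n) (𝓡 n) φ (g x)).toLinearMap := by
    rintro _ ⟨v, rfl⟩
    obtain ⟨w, rfl⟩ := (mdifferentiable_of_mem_maximalAtlas
      hy.domChart_mem_maximalAtlas).mfderiv_surjective (hxy hS) v
    exact ⟨_, ⟨w, rfl⟩,
      (DFunLike.congr_fun (fderiv_sliceMap_comp_inl hy (hxy hS) hφ hxφ) w).symm⟩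
  have hmap : LinearMap.range (fderiv ℝ (φ ∘ g ∘ ψ.symm) (ψ x)).toLinearMap ≤
      (LinearMap.range (mfderiv (𝓡 m) (𝓡 n) g x).toLinearMap).map
        (mfderiv (𝓡 n) (𝓡 n) φ (g x)).toLinearMap := by
    rw [← mfderiv_eq_fderiv]
    rintro _ ⟨v, rfl⟩
    have hcomp := mfderiv_comp_apply_of_eq (ψ x) ((hφ'.mdifferentiableAt hxφ).comp x hg)
      (hψ.mdifferentiableAt_symm (ψ.map_source hxψ)) hsymm v
    rw [mfderiv_comp x (hφ'.mdifferentiableAt hxφ) hg] at hcomp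
    exact ⟨_, ⟨mfderiv (𝓡 m) (𝓡 m) ψ.symm (ψ x) v, rfl⟩, hcomp.symm⟩
  have htop := h _ (domChart_mem_sliceMap_source hy (hxy hS) hxφ)
    ((sliceMap_domChart hy (hxy hS)).trans (by simp [hsymm]))
  refine Submodule.map_injective_of_injective (hφ'.mfderiv_injective hxφ) ?_
  rw [Submodule.map_sup, Submodule.map_top, LinearMap.range_eq_top.2 (hφ'.mfderiv_surjective hxφ)]
  exact eq_top_mono (sup_le_sup hslice hmap) htop

end Transversality

section Perturbation

variable {X Y M N : Type*}
  [NormedAddCommGroup X] [NormedSpace ℝ X] [NormedAddCommGroup Y] [NormedSpace ℝ Y]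

theorem affinePerturb_zero (h : M → Y) (ξ : M → X) (ρ : M → ℝ) :
    affinePerturb h ξ ρ 0 = h := by
  ext x
  simp [affinePerturb]

section Smooth

variable {E H : Type*} [NormedAddCommGroup E] [NormedSpace ℝ E] [TopologicalSpace H]
  {I : ModelWithCorners ℝ E H} [TopologicalSpace M] [ChartedSpace H M]

theorem contMDiffAt_affinePerturb {h : M → Y} {ξ : M → X} {ρ : M → ℝ} {x : M}
    (hh : ContMDiffAt I 𝓘(ℝ, Y) ∞ h x) (hξ : ContMDiffAt I 𝓘(ℝ, X) ∞ ξ x)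
    (hρ : ContMDiffAt I 𝓘(ℝ, ℝ) ∞ ρ x) (s : AffineParam X Y) :
    ContMDiffAt (I.prod 𝓘(ℝ, AffineParam X Y)) 𝓘(ℝ, Y) ∞
      (fun p : M × AffineParam X Y ↦ affinePerturb h ξ ρ p.2 p.1) (x, s) := by
  have hfst : ContMDiffAt (I.prod 𝓘(ℝ, AffineParam X Y)) I ∞
      (Prod.fst : M × AffineParam X Y → M) (x, s) := contMDiffAt_fst
  have hsnd : ContMDiffAt (I.prod 𝓘(ℝ, AffineParam X Y)) 𝓘(ℝ, AffineParam X Y) ∞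
      (Prod.snd : M × AffineParam X Y → AffineParam X Y) (x, s) := contMDiffAt_snd
  have ha := contDiff_fst.contMDiff.contMDiffAt.comp (x, s) hsnd
  have hb := contDiff_snd.contMDiff.contMDiffAt.comp (x, s) hsnd
  exact (hh.comp (x, s) hfst).add
    ((hρ.comp (x, s) hfst).smul (ha.add (hb.clm_apply (hξ.comp (x, s) hfst))))

end Smooth

variable [TopologicalSpace N]

open Classical in
/-- The perturbation of `g` that becomes, in the chart `φ` of the target, the affine perturbation
with parameter `s` and factor `ρ` in the coordinates `ψ` of the source. Where `ρ` vanishes it is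
defined to be `g`, even outside the domain of `φ`. -/
def perturb (g : M → N) (φ : OpenPartialHomeomorph N Y) (ψ : M → X) (ρ : M → ℝ)
    (s : AffineParam X Y) (x : M) : N :=
  if ρ x = 0 then g x else φ.symm (affinePerturb (φ ∘ g) ψ ρ s x)

section Values

variable {g : M → N} {φ : OpenPartialHomeomorph N Y} {ψ : M → X} {ρ : M → ℝ} {x : M}
  {s : AffineParam X Y}

theorem perturb_of_eq_zero (hx : ρ x = 0) : perturb g φ ψ ρ s x = g x := if_pos hx

theorem perturb_of_mem_source (hx : g x ∈ φ.source) :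
    perturb g φ ψ ρ s x = φ.symm (affinePerturb (φ ∘ g) ψ ρ s x) := by
  by_cases h : ρ x = 0
  · simp [perturb, affinePerturb, h, hx]
  · simp [perturb, h]

theorem perturb_zero (hg : MapsTo g (Function.support ρ) φ.source) :
    perturb g φ ψ ρ 0 = g := by
  ext x
  by_cases h : ρ x = 0
  · exact perturb_of_eq_zero h
  · rw [perturb_of_mem_source (hg h), affinePerturb_zero]
    exact φ.left_inv (hg h)

end Values

end Perturbation

section TransversePerturbation

variable {m k n : ℕ} {M N : Type*}
  [TopologicalSpace M] [ChartedSpace (EuclideanSpace ℝ (Fin m)) M]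
  [TopologicalSpace N] [ChartedSpace (EuclideanSpace ℝ (Fin n)) N]
  {S : Set N} [ChartedSpace (EuclideanSpace ℝ (Fin k)) S]
  {g : M → N} {φ : OpenPartialHomeomorph N (EuclideanSpace ℝ (Fin n))}
  {ψ : OpenPartialHomeomorph M (EuclideanSpace ℝ (Fin m))} {ρ : M → ℝ} {x : M}
  {s : AffineParam (EuclideanSpace ℝ (Fin m)) (EuclideanSpace ℝ (Fin n))}
  (hg : ContMDiff (𝓡 m) (𝓡 n) ∞ g) (hφ : φ ∈ IsManifold.maximalAtlas (𝓡 n) ∞ N)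
  (hψ : ψ ∈ IsManifold.maximalAtlas (𝓡 m) ∞ M) (hρ : ContMDiff (𝓡 m) 𝓘(ℝ, ℝ) ∞ ρ)
  (hgρ : MapsTo g (tsupport ρ) φ.source) (hψρ : tsupport ρ ⊆ ψ.source)

include hg hφ hψ hρ hgρ hψρ

theorem contMDiffAt_affinePerturb_chart (hx : x ∈ tsupport ρ)
    (s : AffineParam (EuclideanSpace ℝ (Fin m)) (EuclideanSpace ℝ (Fin n))) :
    ContMDiffAt
      ((𝓡 m).prod 𝓘(ℝ, AffineParam (EuclideanSpace ℝ (Fin m)) (EuclideanSpace ℝ (Fin n))))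
      (𝓡 n) ∞ (fun p : M × AffineParam _ _ ↦ affinePerturb (φ ∘ g) ψ ρ p.2 p.1) (x, s) :=
  contMDiffAt_affinePerturb ((contMDiffAt_of_mem_maximalAtlas hφ (hgρ hx)).comp x hg.contMDiffAt)
    (contMDiffAt_of_mem_maximalAtlas hψ (hψρ hx)) hρ.contMDiffAt s

theorem contMDiffAt_uncurry_perturb
    (hs : x ∈ tsupport ρ → affinePerturb (φ ∘ g) ψ ρ s x ∈ φ.target) :
    ContMDiffAt
      ((𝓡 m).prod 𝓘(ℝ, AffineParam (EuclideanSpace ℝ (Fin m)) (EuclideanSpace ℝ (Fin n))))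
      (𝓡 n) ∞ (fun p : M × AffineParam _ _ ↦ perturb g φ ψ ρ p.2 p.1) (x, s) := by
  by_cases hx : x ∈ tsupport ρ
  · have hφg : ∀ᶠ p : M × AffineParam (EuclideanSpace ℝ (Fin m)) (EuclideanSpace ℝ (Fin n))
        in 𝓝 (x, s), g p.1 ∈ φ.source :=
      (hg.continuous.comp continuous_fst).continuousAt (φ.open_source.mem_nhds (hgρ hx))
    refine ((contMDiffAt_symm_of_mem_maximalAtlas hφ (hs hx)).comp (x, s)
      (contMDiffAt_affinePerturb_chart hg hφ hψ hρ hgρ hψρ hx s)).congr_of_eventuallyEq ?_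
    filter_upwards [hφg] with p hp using perturb_of_mem_source hp
  · have hρ0 : ∀ᶠ p : M × AffineParam (EuclideanSpace ℝ (Fin m)) (EuclideanSpace ℝ (Fin n))
        in 𝓝 (x, s), p.1 ∈ (tsupport ρ)ᶜ :=
      continuous_fst.continuousAt ((isClosed_tsupport ρ).isOpen_compl.mem_nhds hx)
    refine (hg.contMDiffAt.comp (x, s) contMDiffAt_fst).congr_of_eventuallyEq ?_
    filter_upwards [hρ0] with p hp using perturb_of_eq_zero (image_eq_zero_of_notMem_tsupport hp)

theorem contMDiffAt_perturb
    (hs : x ∈ tsupport ρ → affinePerturb (φ ∘ g) ψ ρ s x ∈ φ.target) :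
    ContMDiffAt (𝓡 m) (𝓡 n) ∞ (perturb g φ ψ ρ s) x :=
  ContMDiffAt.comp (f := fun x' : M ↦ (x', s)) x
    (contMDiffAt_uncurry_perturb hg hφ hψ hρ hgρ hψρ hs)
    (contMDiffAt_id.prodMk contMDiffAt_const)

theorem chart_comp_perturb_eventuallyEq (hx : x ∈ tsupport ρ)
    (hs : affinePerturb (φ ∘ g) ψ ρ s x ∈ φ.target) :
    φ ∘ perturb g φ ψ ρ s =ᶠ[𝓝 x] affinePerturb (φ ∘ g) ψ ρ s := by
  have hcont : ContinuousAt (affinePerturb (φ ∘ g) ψ ρ s) x :=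
    (contMDiffAt_affinePerturb_chart hg hφ hψ hρ hgρ hψρ hx s).continuousAt.comp_of_eq
      (f := fun x' ↦ (x', s)) (by fun_prop) rfl
  filter_upwards [hg.continuous.continuousAt (φ.open_source.mem_nhds (hgρ hx)),
    hcont (φ.open_target.mem_nhds hs)] with x' hx' hx't
  rw [Function.comp_apply, perturb_of_mem_source hx', φ.right_inv hx't]

theorem eventually_forall_affinePerturb_mem_target (hρc : HasCompactSupport ρ) {O : Set (M × N)}
    (hO : IsOpen O) (hgO : ∀ x, (x, g x) ∈ O) :
    ∀ᶠ s : AffineParam (EuclideanSpace ℝ (Fin m)) (EuclideanSpace ℝ (Fin n)) in 𝓝 0,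
      ∀ x ∈ tsupport ρ, affinePerturb (φ ∘ g) ψ ρ s x ∈ φ.target ∧
        (x, perturb g φ ψ ρ s x) ∈ O := by
  refine hρc.isCompact.eventually_forall_of_forall_eventually fun x hx ↦ ?_
  have htarget : affinePerturb (φ ∘ g) ψ ρ 0 x ∈ φ.target := by
    rw [affinePerturb_zero]
    exact φ.map_source (hgρ hx)
  have hperturb : perturb g φ ψ ρ 0 x = g x :=
    congrFun (perturb_zero (hgρ.mono_left (subset_tsupport ρ))) x
  have hswap : Tendsto Prod.swap (𝓝 (0, x)) (𝓝 (x, (0 :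
      AffineParam (EuclideanSpace ℝ (Fin m)) (EuclideanSpace ℝ (Fin n))))) :=
    continuous_swap.continuousAt
  have haff := (contMDiffAt_affinePerturb_chart hg hφ hψ hρ hgρ hψρ hx 0).continuousAt
  have hper := (contMDiffAt_uncurry_perturb hg hφ hψ hρ hgρ hψρ fun _ ↦ htarget).continuousAt
  refine (hswap.eventually (haff.eventually (φ.open_target.mem_nhds htarget))).and
    (hswap.eventually ((continuousAt_fst.prodMk hper).eventually (hO.mem_nhds ?_)))
  simpa [hperturb] using hgO x

theorem TransverseAt.perturb (h : TransverseAt m k n S g x) (hρ0 : ρ x = 0)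
    (hmin : IsLocalMin ρ x)
    (s : AffineParam (EuclideanSpace ℝ (Fin m)) (EuclideanSpace ℝ (Fin n))) :
    TransverseAt m k n S (perturb g φ ψ ρ s) x := by
  by_cases hx : x ∈ tsupport ρ
  · have htarget : affinePerturb (φ ∘ g) ψ ρ s x ∈ φ.target := by
      simpa [affinePerturb, hρ0] using φ.map_source (hgρ hx)
    have hρd : MDifferentiableAt (𝓡 m) 𝓘(ℝ, ℝ) ρ x := hρ.mdifferentiable (by simp) x
    have haff : MDifferentiableAt (𝓡 m) (𝓡 n) (fun y ↦ s.1 + s.2 (ψ y)) x :=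
      mdifferentiableAt_const.add (s.2.differentiableAt.mdifferentiableAt.comp x
        ((mdifferentiable_of_mem_maximalAtlas hψ).mdifferentiableAt (hψρ hx)))
    refine h.of_chart_comp_eventuallyEq_add (hg.mdifferentiable (by simp) x)
      ((contMDiffAt_perturb hg hφ hψ hρ hgρ hψρ fun _ ↦ htarget).mdifferentiableAt (by simp))
      (mdifferentiable_of_mem_maximalAtlas hφ) (hgρ hx) ?_ (hρd.smul haff) (by simp [hρ0])
      (mvfderiv_smul_eq_zero_of_isLocalMin hρd hmin hρ0 haff)
      (chart_comp_perturb_eventuallyEq hg hφ hψ hρ hgρ hψρ hx htarget)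
    rw [perturb_of_eq_zero hρ0]
    exact hgρ hx
  · refine h.congr_of_eventuallyEq ?_
    filter_upwards [(isClosed_tsupport ρ).isOpen_compl.mem_nhds hx] with y hy
    exact perturb_of_eq_zero (image_eq_zero_of_notMem_tsupport hy)

theorem transverseAt_perturb_of_transverseToSliceAt {F : Type*} [NormedAddCommGroup F]
    [NormedSpace ℝ F] {y : S}
    (hy : Manifold.IsImmersionAtOfComplement F (𝓡 k) (𝓡 n) ∞ (Subtype.val : S → N) y)
    (hx : x ∈ tsupport ρ) (hs : affinePerturb (φ ∘ g) ψ ρ s x ∈ φ.target)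
    (hxy : ∀ hS : perturb g φ ψ ρ s x ∈ S, ⟨_, hS⟩ ∈ hy.domChart.source)
    (h : TransverseToSliceAt (sliceMap hy φ) (sliceMap hy φ).source
      (affinePerturb (φ ∘ g ∘ ψ.symm) id (ρ ∘ ψ.symm) s) (ψ x)) :
    TransverseAt m k n S (perturb g φ ψ ρ s) x := by
  have hgerm : affinePerturb (φ ∘ g ∘ ψ.symm) id (ρ ∘ ψ.symm) s =ᶠ[𝓝 (ψ x)]
      φ ∘ perturb g φ ψ ρ s ∘ ψ.symm := by
    filter_upwards [ψ.open_target.mem_nhds (ψ.map_source (hψρ hx)),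
      (ψ.tendsto_symm (hψρ hx)).eventually
        (chart_comp_perturb_eventuallyEq hg hφ hψ hρ hgρ hψρ hx hs)] with z hz hzx
    simpa [affinePerturb, ψ.right_inv hz] using hzx.symm
  refine transverseAt_of_transverseToSliceAt hy
    ((contMDiffAt_perturb hg hφ hψ hρ hgρ hψρ fun _ ↦ hs).mdifferentiableAt (by simp)) hφ ?_
    (mdifferentiable_of_mem_maximalAtlas hψ) (hψρ hx) hxy (h.congr_of_eventuallyEq hgerm)
  rw [perturb_of_mem_source (hgρ hx)]
  exact φ.map_target hs

theorem dimH_setOf_not_transverseAt_perturb_le {F : Type*} [NormedAddCommGroup F]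
    [NormedSpace ℝ F] {y : S}
    (hy : Manifold.IsImmersionAtOfComplement F (𝓡 k) (𝓡 n) ∞ (Subtype.val : S → N) y) :
    dimH {s | ∃ x, ρ x ≠ 0 ∧ affinePerturb (φ ∘ g) ψ ρ s x ∈ φ.target ∧
      (∀ hS : perturb g φ ψ ρ s x ∈ S, ⟨_, hS⟩ ∈ hy.domChart.source) ∧
      ¬ TransverseAt m k n S (perturb g φ ψ ρ s) x} ≤
    (finrank ℝ (AffineParam (EuclideanSpace ℝ (Fin m)) (EuclideanSpace ℝ (Fin n))) - 1 : ℕ) := by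
  have : FiniteDimensional ℝ (EuclideanSpace ℝ (Fin k) × F) :=
    hy.equiv.symm.toLinearEquiv.finiteDimensional
  have : FiniteDimensional ℝ F := FiniteDimensional.of_injective
    (LinearMap.inr ℝ (EuclideanSpace ℝ (Fin k)) F) LinearMap.inr_injective
  have hdim : finrank ℝ (EuclideanSpace ℝ (Fin n)) =
      finrank ℝ (EuclideanSpace ℝ (Fin k)) + finrank ℝ F := by
    rw [← hy.equiv.toLinearEquiv.finrank_eq, finrank_prod]
  let Ω : Set (EuclideanSpace ℝ (Fin m)) := ψ.target ∩ ψ.symm ⁻¹' Function.support ρ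
  have hΩ : IsOpen Ω := ψ.isOpen_inter_preimage_symm hρ.continuous.isOpen_support
  have hψΩ : ContMDiffOn (𝓡 m) (𝓡 m) ∞ ψ.symm Ω :=
    (contMDiffOn_symm_of_mem_maximalAtlas hψ).mono inter_subset_left
  have hc : ContDiffOn ℝ ∞ (ρ ∘ ψ.symm) Ω := (hρ.comp_contMDiffOn hψΩ).contDiffOn
  have hu : ContDiffOn ℝ ∞ (φ ∘ g ∘ ψ.symm) Ω :=
    ((contMDiffOn_of_mem_maximalAtlas hφ).comp (hg.comp_contMDiffOn hψΩ)
      fun x hx ↦ hgρ (subset_tsupport ρ hx.2)).contDiffOn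
  refine (dimH_mono ?_).trans (dimH_setOf_not_transverseToSliceAt_le hΩ hu hc (fun x hx ↦ hx.2)
    (sliceMap hy φ).open_source (contDiffOn_sliceMap hy hφ)
    (fun p ↦ surjective_fderiv_sliceMap hy hφ) hdim)
  rintro s ⟨x, hx, hs, hxy, hnt⟩
  have hxρ : x ∈ tsupport ρ := subset_tsupport ρ hx
  have hinv : ψ.symm (ψ x) = x := ψ.left_inv (hψρ hxρ)
  refine ⟨ψ x, ⟨ψ.map_source (hψρ hxρ), by simpa [hinv] using hx⟩, fun h ↦ hnt ?_⟩
  exact transverseAt_perturb_of_transverseToSliceAt hg hφ hψ hρ hgρ hψρ hy hxρ hs hxy h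

theorem dense_setOf_transverseAt_perturb [LindelofSpace S]
    (hS : Manifold.IsImmersion (𝓡 k) (𝓡 n) ∞ (Subtype.val : S → N)) :
    Dense {s | ∀ x, ρ x ≠ 0 → affinePerturb (φ ∘ g) ψ ρ s x ∈ φ.target →
      TransverseAt m k n S (perturb g φ ψ ρ s) x} := by
  rcases Nat.eq_zero_or_pos n with rfl | hn
  · have : Subsingleton (Submodule ℝ (EuclideanSpace ℝ (Fin 0))) := inferInstance
    exact dense_univ.mono fun s _ x _ _ _ ↦ this.elim _ _
  obtain ⟨F, _, _, hF⟩ := hS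
  obtain ⟨t, htc, ht⟩ := countable_cover_nhds fun y ↦
    (hF y).domChart.open_source.mem_nhds (hF y).mem_domChart_source
  have : Countable t := htc.to_subtype
  have hpos : finrank ℝ (AffineParam (EuclideanSpace ℝ (Fin m)) (EuclideanSpace ℝ (Fin n))) - 1 <
      finrank ℝ (AffineParam (EuclideanSpace ℝ (Fin m)) (EuclideanSpace ℝ (Fin n))) := by
    rw [finrank_prod, finrank_euclideanSpace_fin]
    omega
  refine (dense_compl_iUnion_of_dimH_le hpos fun y : t ↦
    dimH_setOf_not_transverseAt_perturb_le hg hφ hψ hρ hgρ hψρ (hF y)).mono ?_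
  intro s hs x hx hxt
  by_contra hnt
  obtain ⟨hxS, -⟩ := not_forall.1 hnt
  obtain ⟨y, hyt, hy⟩ := mem_iUnion₂.1 (ht ▸ mem_univ (⟨_, hxS⟩ : S))
  exact hs (mem_iUnion.2 ⟨⟨y, hyt⟩, x, hx, hxt, fun _ ↦ hy, hnt⟩)

theorem exists_homotopicRel_perturb (hs : ∀ t : unitInterval, ∀ x ∈ tsupport ρ,
      affinePerturb (φ ∘ g) ψ ρ ((t : ℝ) • s) x ∈ φ.target) :
    ∃ g' : C(M, N), ⇑g' = perturb g φ ψ ρ s ∧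
      ContinuousMap.HomotopicRel ⟨g, hg.continuous⟩ g' (Function.support ρ)ᶜ := by
  have hH : Continuous fun p : unitInterval × M ↦ perturb g φ ψ ρ ((p.1 : ℝ) • s) p.2 :=
    continuous_iff_continuousAt.2 fun p ↦
      (contMDiffAt_uncurry_perturb hg hφ hψ hρ hgρ hψρ (hs p.1 p.2)).continuousAt.comp_of_eq
        (f := fun q : unitInterval × M ↦ (q.2, (q.1 : ℝ) • s)) (by fun_prop) rfl
  refine ⟨⟨perturb g φ ψ ρ s, ?_⟩, rfl, ⟨⟨⟨⟨_, hH⟩, fun x ↦ ?_, fun x ↦ ?_⟩, ?_⟩⟩⟩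
  · simpa [Function.comp_def] using hH.comp (Continuous.prodMk_right (1 : unitInterval))
  · simp [perturb_zero (hgρ.mono_left (subset_tsupport ρ))]
  · simp
  · exact fun t x hx ↦ perturb_of_eq_zero (Function.notMem_support.1 hx)

end TransversePerturbation

section LocalToGlobal

theorem exists_nat_locallyFinite_cover_chartAt_source {H H' M N : Type*} [TopologicalSpace H]
    [TopologicalSpace H'] [TopologicalSpace M] [T2Space M] [SecondCountableTopology M]
    [LocallyCompactSpace M] [Nonempty M] [ChartedSpace H M] [TopologicalSpace N]
    [ChartedSpace H' N] {f : M → N} (hf : Continuous f) :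
    ∃ (c : ℕ → M) (W : ℕ → Set M), (∀ i, IsOpen (W i)) ∧ ⋃ i, W i = univ ∧ LocallyFinite W ∧
      (∀ i, IsCompact (closure (W i))) ∧ (∀ i, closure (W i) ⊆ (chartAt H (c i)).source) ∧
      ∀ i, MapsTo f (closure (W i)) (chartAt H' (f (c i))).source := by
  choose K hKx hKU hK using fun x : M ↦ local_compact_nhds (inter_mem
    (chart_source_mem_nhds H x) (hf.continuousAt (chart_source_mem_nhds H' (f x))))
  obtain ⟨c, W, hWo, hWu, hWlf, hWK⟩ := exists_nat_locallyFinite_refinement hKx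
  have hcl (i : ℕ) : closure (W i) ⊆ K (c i) := closure_minimal (hWK i) (hK (c i)).isClosed
  exact ⟨c, W, hWo, hWu, hWlf, fun i ↦ (hK (c i)).of_isClosed_subset isClosed_closure (hcl i),
    fun i x hx ↦ (hKU _ (hcl i hx)).1, fun i x hx ↦ (hKU _ (hcl i hx)).2⟩

variable {m k n : ℕ} {M N : Type*}
  [TopologicalSpace M] [T2Space M] [SecondCountableTopology M]
  [ChartedSpace (EuclideanSpace ℝ (Fin m)) M] [IsManifold (𝓡 m) ∞ M]
  [TopologicalSpace N] [ChartedSpace (EuclideanSpace ℝ (Fin n)) N]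
  {S : Set N} [ChartedSpace (EuclideanSpace ℝ (Fin k)) S] [LindelofSpace S]
  (hS : Manifold.IsImmersion (𝓡 k) (𝓡 n) ∞ (Subtype.val : S → N))

include hS

theorem exists_homotopicRel_compl_transverseOn {g : C(M, N)} (hg : ContMDiff (𝓡 m) (𝓡 n) ∞ g)
    {φ : OpenPartialHomeomorph N (EuclideanSpace ℝ (Fin n))}
    (hφ : φ ∈ IsManifold.maximalAtlas (𝓡 n) ∞ N)
    {ψ : OpenPartialHomeomorph M (EuclideanSpace ℝ (Fin m))}
    (hψ : ψ ∈ IsManifold.maximalAtlas (𝓡 m) ∞ M)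
    {W : Set M} (hW : IsOpen W) (hWc : IsCompact (closure W)) (hWψ : closure W ⊆ ψ.source)
    (hgW : MapsTo g (closure W) φ.source)
    {O : Set (M × N)} (hO : IsOpen O) (hgO : ∀ x, (x, g x) ∈ O) :
    ∃ g' : C(M, N), ContMDiff (𝓡 m) (𝓡 n) ∞ g' ∧ (∀ x, (x, g' x) ∈ O) ∧
      g.HomotopicRel g' Wᶜ ∧ TransverseOn m k n S g' W ∧
      ∀ x, TransverseAt m k n S g x → TransverseAt m k n S g' x := by
  have : LocallyCompactSpace M := ChartedSpace.locallyCompactSpace (EuclideanSpace ℝ (Fin m)) M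
  obtain ⟨ρ, rfl, hρ, hρ0⟩ := hW.exists_contMDiff_support_eq (n := ⊤) (𝓡 m)
  obtain ⟨δ, hδ, hball⟩ := Metric.eventually_nhds_iff_ball.1
    (eventually_forall_affinePerturb_mem_target hg hφ hψ hρ hgW hWψ hWc hO hgO)
  obtain ⟨s, hsδ, hs⟩ :=
    (dense_setOf_transverseAt_perturb hg hφ hψ hρ hgW hWψ hS).inter_open_nonempty _
      Metric.isOpen_ball ⟨0, Metric.mem_ball_self hδ⟩
  have htarget (x : M) (hx : x ∈ tsupport ρ) : affinePerturb (φ ∘ g) ψ ρ s x ∈ φ.target :=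
    (hball s hsδ x hx).1
  have hseg (t : unitInterval) : (t : ℝ) • s ∈ Metric.ball 0 δ :=
    (convex_ball 0 δ).smul_mem_of_zero_mem (Metric.mem_ball_self hδ) hsδ t.2
  obtain ⟨g', hg', hgg'⟩ := exists_homotopicRel_perturb hg hφ hψ hρ hgW hWψ
    fun t x hx ↦ (hball _ (hseg t) x hx).1
  refine ⟨g', ?_, fun x ↦ ?_, hgg', fun x hx ↦ ?_, fun x hx ↦ ?_⟩
  all_goals rw [hg']
  · exact fun x ↦ contMDiffAt_perturb hg hφ hψ hρ hgW hWψ (htarget x)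
  · by_cases hx : x ∈ tsupport ρ
    · exact (hball s hsδ x hx).2
    · rw [perturb_of_eq_zero (image_eq_zero_of_notMem_tsupport hx)]
      exact hgO x
  · exact hs x hx (htarget x (subset_tsupport ρ hx))
  · by_cases hx0 : ρ x = 0
    · exact hx.perturb hg hφ hψ hρ hgW hWψ hx0 (.of_forall fun y ↦ hx0.trans_le (hρ0 y)) s
    · exact hs x hx0 (htarget x (subset_tsupport ρ hx0))

theorem exists_homotopicRel_transverseOn_iUnion {W : ℕ → Set M}
    (hW : LocallyFinite W) (hWo : ∀ i, IsOpen (W i)) (hWc : ∀ i, IsCompact (closure (W i)))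
    {φ : ℕ → OpenPartialHomeomorph N (EuclideanSpace ℝ (Fin n))}
    (hφ : ∀ i, φ i ∈ IsManifold.maximalAtlas (𝓡 n) ∞ N)
    {ψ : ℕ → OpenPartialHomeomorph M (EuclideanSpace ℝ (Fin m))}
    (hψ : ∀ i, ψ i ∈ IsManifold.maximalAtlas (𝓡 m) ∞ M)
    (hWψ : ∀ i, closure (W i) ⊆ (ψ i).source)
    {f : C(M, N)} (hf : ContMDiff (𝓡 m) (𝓡 n) ∞ f)
    (hfW : ∀ i, MapsTo f (closure (W i)) (φ i).source) :
    ∃ g : C(M, N), ContMDiff (𝓡 m) (𝓡 n) ∞ g ∧ f.HomotopicRel g (⋃ i, W i)ᶜ ∧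
      TransverseOn m k n S g (⋃ i, W i) ∧
      ∀ x, TransverseAt m k n S f x → TransverseAt m k n S g x := by
  let O : Set (M × N) := {p | ∀ i, p.1 ∈ closure (W i) → p.2 ∈ (φ i).source}
  have hO : IsOpen O := isOpen_setOf_forall_mem_imp_mem hW.closure (fun _ ↦ isClosed_closure)
    fun i ↦ (φ i).open_source
  obtain ⟨g, hfg, hg, hgW, hmono⟩ := exists_homotopicRel_of_forall_exists_homotopicRel
    (P := fun g : C(M, N) ↦ ContMDiff (𝓡 m) (𝓡 n) ∞ g ∧ ∀ x, (x, g x) ∈ O)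
    (T := fun g x ↦ TransverseAt m k n S g x) hW
    (fun g g' x hgg' h ↦ h.congr_of_eventuallyEq hgg'.symm)
    (fun i g hg ↦ by
      obtain ⟨g', hg', hg'O, h⟩ := exists_homotopicRel_compl_transverseOn hS hg.1 (hφ i) (hψ i)
        (hWo i) (hWc i) (hWψ i) (fun x hx ↦ hg.2 x i hx) hO hg.2
      exact ⟨g', ⟨hg', hg'O⟩, h⟩)
    ⟨hf, fun x i hx ↦ hfW i hx⟩
  refine ⟨g, fun x ↦ ?_, hfg, hgW, hmono⟩
  obtain ⟨g', hg', hgg'⟩ := hg x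
  exact hg'.1.contMDiffAt.congr_of_eventuallyEq hgg'.symm

end LocalToGlobal

end Transversality

end

theorem corollary2_general {m k n : ℕ} {M N : Type*}
    [TopologicalSpace M] [T2Space M] [SecondCountableTopology M]
    [ChartedSpace (EuclideanSpace ℝ (Fin m)) M] [IsManifold (𝓡 m) ∞ M]
    [TopologicalSpace N] [ChartedSpace (EuclideanSpace ℝ (Fin n)) N] [IsManifold (𝓡 n) ∞ N]
    {S : Set N} [ChartedSpace (EuclideanSpace ℝ (Fin k)) S] [LindelofSpace S]
    (hS : Manifold.IsImmersion (𝓡 k) (𝓡 n) ∞ (Subtype.val : S → N))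
    (f : C(M, N)) (hf : ContMDiff (𝓡 m) (𝓡 n) ∞ f)
    {A : Set M} (hA : IsClosed A) (hfA : Transversality.TransverseOn m k n S f A) :
    ∃ g : C(M, N), ContMDiff (𝓡 m) (𝓡 n) ∞ g ∧ f.HomotopicRel g A ∧
      Transversality.Transverse m k n S g := by
  rcases isEmpty_or_nonempty M with hM | hM
  · exact ⟨f, hf, .refl f, hM.elim⟩
  have : LocallyCompactSpace M := ChartedSpace.locallyCompactSpace (EuclideanSpace ℝ (Fin m)) M
  obtain ⟨c, W, hWo, hWu, hWlf, hWc, hWψ, hfW⟩ :=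
    Transversality.exists_nat_locallyFinite_cover_chartAt_source
      (H := EuclideanSpace ℝ (Fin m)) (H' := EuclideanSpace ℝ (Fin n)) f.continuous
  have hcl (i : ℕ) : closure (W i \ A) ⊆ closure (W i) := closure_mono Set.sdiff_subset
  obtain ⟨g, hg, hfg, hgW, hmono⟩ := Transversality.exists_homotopicRel_transverseOn_iUnion hS
    (hWlf.subset fun i ↦ Set.sdiff_subset) (fun i ↦ (hWo i).sdiff hA)
    (fun i ↦ (hWc i).of_isClosed_subset isClosed_closure (hcl i))
    (fun i ↦ IsManifold.chart_mem_maximalAtlas (f (c i)))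
    (fun i ↦ IsManifold.chart_mem_maximalAtlas (c i))
    (fun i ↦ (hcl i).trans (hWψ i)) hf fun i ↦ (hfW i).mono_left (hcl i)
  rw [← Set.iUnion_sdiff, hWu, ← Set.compl_eq_univ_sdiff] at hfg hgW
  rw [compl_compl] at hfg
  refine ⟨g, hg, hfg, fun x ↦ ?_⟩
  by_cases hx : x ∈ A
  · exact hmono x (hfA x hx)
  · exact hgW x hx

theorem corollary2 {m k n : ℕ} {M N : Type*}
    [TopologicalSpace M] [T2Space M] [SecondCountableTopology M]
    [ChartedSpace (EuclideanSpace ℝ (Fin m)) M] [IsManifold (𝓡 m) ∞ M]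
    [TopologicalSpace N] [T2Space N] [SecondCountableTopology N]
    [ChartedSpace (EuclideanSpace ℝ (Fin n)) N] [IsManifold (𝓡 n) ∞ N]
    (S : Set N) [ChartedSpace (EuclideanSpace ℝ (Fin k)) S]
    (hS : Transversality.IsSubmanifold k n S)
    (f : C(M, N)) (hf : ContMDiff (𝓡 m) (𝓡 n) ∞ f) :
    (∃ g : C(M, N), ContMDiff (𝓡 m) (𝓡 n) ∞ g ∧ f.Homotopic g ∧
      Transversality.Transverse m k n S g) ∧
    ∀ A : Set M, IsClosed A → Transversality.TransverseOn m k n S f A →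
      ∃ g : C(M, N), ContMDiff (𝓡 m) (𝓡 n) ∞ g ∧ f.Homotopic g ∧
        Transversality.Transverse m k n S g ∧ Set.EqOn g f A := by
  have key {A : Set M} := corollary2_general (A := A) hS.isSmoothEmbedding.isImmersion f hf
  refine ⟨(key isClosed_empty fun x hx ↦ hx.elim).imp fun g ⟨hg, hfg, hgS⟩ ↦
    ⟨hg, hfg.homotopic, hgS⟩, fun A hA hfA ↦ (key hA hfA).imp fun g ⟨hg, hfg, hgS⟩ ↦
    ⟨hg, hfg.homotopic, hgS, fun x hx ↦ (hfg.fst_eq_snd hx).symm⟩⟩
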